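/- Let $n\ge 2$ and let $\mathcal B_m$ be Artin's braid group on $m$ strands, with Artin generators $\sigma_1,\dots,\sigma_{m-1}$. For $H\le\mathcal B_n$, the elements of the infinitely braided Thompson group $BV_n(H)$ are represented by tuples $(T,\beta,\lambda,T')$, where $T,T'$ are finite full $n$-ary trees with the same number $m$ of leaves, $\beta\in\mathcal B_m$ is a braid from the leaves of $T$ to those of $T'$, and $\lambda=(h_1,\dots,h_m)$ with $h_q\in H$ labels the strand of $\beta$ ending at the $q$-th leaf of $T'$. Tuples are identified under the equivalence relation generated by expansions: for a strand from leaf $p$ of $T$ to leaf $q$ of $T'$ with label $h=h_q$, append a caret to both leaves, replace the strand by $n$ parallel strands followed by the braid $h$, and label all $n$ new strands by $h$. The product is computed on representatives with matching middle tree by $(T,\beta,\lambda,T')(T',\beta',\lambda',T'')=(T,\beta\beta',\lambda'',T'')$, the labels met along each strand being multiplied. Write $\overrightarrow{Id}$ for trivial labels. The depth of a tree is its number of carets (interior vertices); an element has depth less than $d$ if it has a representative whose trees have depth less than $d$. A caret is final if all its leaves are leaves of the tree. A braid is simple if it is represented by a positive word in the Artin generators along which every pair of strands crosses at most once. For final carets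 $c$ of $T$ and $c'$ of $T'$, the ribbon connecting $c$ to $c'$ is the braid of minimal length among the simple braids $\beta$ such that $(T,\beta,T')$ contains a trivial sub-braid (a tube of parallel strands met by no other strand) connecting the leaves of $c$ to those of $c'$. Proposition. Let $H\le\mathcal B_n$ and let $v=(T_1,\beta,\lambda,T_2)\in BV_n(H)$ be such that $T_1$ (and hence $T_2$) has depth $d>4$. There exist full $n$-ary trees of depth $d$ with exactly $3$ final carets, and for every such tree $T_3$ the element $v$ is a product of finitely many elements of $BV_n(\mathcal B_n)$ of depth less than $d$, each of which has a representative $(T_1',\beta',\lambda',T_2')$ satisfying one of the following: 1. $T_2'=T_3$, $\beta'$ is a ribbon connecting a final caret of $T_1'$ to a final caret of $T_3$, and $\lambda'=\overrightarrow{Id}$; 2. $T_1'=T_3$, $\beta'$ is a ribbon connecting a final caret of $T_3$ to a final caret of $T_2'$, and $\lambda'=\overrightarrow{Id}$; 3. $T_1'=T_2'=T_3$, $\beta'=\sigma_i^{\pm1}$ for an Artin generator $\sigma_i$, and $\lambda'=\overrightarrow{Id}$; 4. $T_1'=T_2'$ has depth $1$, $\beta'$ is trivial and $\lambda'=(\sigma_i^{\pm1},Id,\dots,Id)$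 for an Artin generator $\sigma_i$ of $\mathcal B_n$. -/

import Mathlib

/-! ### Braid groups -/

/-- The defining relators of Artin's braid group on `m` strands, on generators `σ_0, …, σ_{m-2}`
(indices start at `0`). -/
inductive BraidRel (m : ℕ) : FreeGroup (Fin (m - 1)) → Prop
  | comm (i j : Fin (m - 1)) (h : i.1 + 1 < j.1) :
      BraidRel m (FreeGroup.of i * FreeGroup.of j * (FreeGroup.of j * FreeGroup.of i)⁻¹)
  | braid (i j : Fin (m - 1)) (h : i.1 + 1 = j.1) :
      BraidRel m (FreeGroup.of i * FreeGroup.of j * FreeGroup.of i *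
        (FreeGroup.of j * FreeGroup.of i * FreeGroup.of j)⁻¹)

/-- Artin's braid group on `m` strands. A product `β * γ` is `β` followed by `γ`, read from top
to bottom. -/
abbrev BraidGroup (m : ℕ) : Type := PresentedGroup {r | BraidRel m r}

/-- The Artin generator `σ_i`: the strand in position `i` passes over the strand in position
`i + 1` (positions are counted from `0`). -/
def BraidGroup.sigma {m : ℕ} (i : Fin (m - 1)) : BraidGroup m := PresentedGroup.of i

/-- The transposition of the positions `i` and `i + 1`. -/
def adjacentSwap {m : ℕ} (i : Fin (m - 1)) : Equiv.Perm (Fin m) :=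
  Equiv.swap ⟨i.1, by omega⟩ ⟨i.1 + 1, by omega⟩

theorem adjacentSwap_comm {m : ℕ} (i j : Fin (m - 1)) (h : i.1 + 1 < j.1) :
    adjacentSwap i * adjacentSwap j = adjacentSwap j * adjacentSwap i := by
  apply Equiv.Perm.Disjoint.commute
  intro x
  simp only [adjacentSwap]
  by_cases hx : x.1 = i.1 ∨ x.1 = i.1 + 1
  · right
    apply Equiv.swap_apply_of_ne_of_ne <;> (intro e; have := congrArg Fin.val e; simp at this; omega)
  · left
    apply Equiv.swap_apply_of_ne_of_ne <;> (intro e; have := congrArg Fin.val e; simp at this; omega)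

theorem adjacentSwap_braid {m : ℕ} (i j : Fin (m - 1)) (h : i.1 + 1 = j.1) :
    adjacentSwap i * adjacentSwap j * adjacentSwap i =
      adjacentSwap j * adjacentSwap i * adjacentSwap j := by
  ext x
  simp only [adjacentSwap, Equiv.Perm.mul_apply, Equiv.swap_apply_def, Fin.ext_iff]
  grind

/-- The homomorphism sending `σ_i` to the transposition of the positions `i` and `i + 1`; the
opposite group appears because products of braids are read from left to right. -/
def BraidGroup.permHom (m : ℕ) : BraidGroup m →* (Equiv.Perm (Fin m))ᵐᵒᵖ :=
  PresentedGroup.toGroup (f := fun i => MulOpposite.op (adjacentSwap i)) (by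
    rintro r (⟨i, j, h⟩ | ⟨i, j, h⟩)
    · simp only [map_mul, map_inv, FreeGroup.lift_apply_of, mul_inv_eq_one, ← MulOpposite.op_mul]
      rw [adjacentSwap_comm i j h]
    · simp only [map_mul, map_inv, FreeGroup.lift_apply_of, mul_inv_eq_one, ← MulOpposite.op_mul,
        ← mul_assoc]
      rw [adjacentSwap_braid i j h])

/-- `β.perm p` is the bottom position of the strand of `β` whose top position is `p`. -/
def BraidGroup.perm {m : ℕ} (β : BraidGroup m) : Equiv.Perm (Fin m) :=
  (BraidGroup.permHom m β).unop

/-- Braid words: the letter `(i, true)` is `σ_i` and `(i, false)` is its inverse. -/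
abbrev BraidWord : Type := List (ℕ × Bool)

/-- A word on `m` strands only crosses positions smaller than `m`. -/
def BraidWord.IsValid (m : ℕ) (w : BraidWord) : Prop := ∀ x ∈ w, x.1 + 1 < m

/-- The braid of a letter (the value `1` for letters that do not exist on `m` strands is never
used: words are always required to be valid). -/
def BraidWord.letter (m : ℕ) (x : ℕ × Bool) : BraidGroup m :=
  if h : x.1 < m - 1 then
    if x.2 then BraidGroup.sigma ⟨x.1, h⟩ else (BraidGroup.sigma ⟨x.1, h⟩)⁻¹
  else 1

/-- The braid on `m` strands represented by a word. -/
def BraidWord.toBraid (m : ℕ) (w : BraidWord) : BraidGroup m :=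
  (w.map (BraidWord.letter m)).prod

/-- A single crossing in which the strand in position `p` is replaced by `n` parallel strands, in
positions `p, …, p + n - 1`. -/
def BraidWord.cableLetter (n p : ℕ) (x : ℕ × Bool) : BraidWord :=
  if x.1 + 1 < p then [x]
  else if x.1 + 1 = p then (List.range n).map fun k => (x.1 + k, x.2)
  else if x.1 = p then (List.range n).reverse.map fun k => (x.1 + k, x.2)
  else [(x.1 + n - 1, x.2)]

/-- The word in which the strand with top position `p` is replaced by `n` parallel strands. -/
def BraidWord.cable (n : ℕ) : BraidWord → ℕ → BraidWord
  | [], _ => []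
  | x :: w, p => BraidWord.cableLetter n p x ++
      BraidWord.cable n w (Equiv.swap x.1 (x.1 + 1) p)

/-- The word with all positions moved `q` places to the right. -/
def BraidWord.shift (q : ℕ) (w : BraidWord) : BraidWord := w.map fun x => (q + x.1, x.2)

/-! ### Trees -/

/-- Finite full `n`-ary rooted trees. -/
inductive NTree (n : ℕ) : Type
  | leaf : NTree n
  | node (children : Fin n → NTree n) : NTree n

namespace NTree

variable {n : ℕ}

/-- The number of leaves. -/
def numLeaves : NTree n → ℕ
  | leaf => 1
  | node f => ∑ i, (f i).numLeaves

/-- The depth of a tree in the sense used here: its number of carets, that is, of interior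
vertices. -/
def depth : NTree n → ℕ
  | leaf => 0
  | node f => 1 + ∑ i, (f i).depth

/-- `T.ExpandsAt p T'`: the tree `T'` is obtained from `T` by appending a final caret to the
leaf of `T` in position `p` (leaves are ordered from left to right, counted from `0`). The leaves
of the new caret are in positions `p, …, p + n - 1` of `T'`. -/
inductive ExpandsAt : NTree n → ℕ → NTree n → Prop
  | leaf : ExpandsAt leaf 0 (node fun _ => leaf)
  | node (f : Fin n → NTree n) (j : Fin n) (p : ℕ) (t : NTree n) (h : ExpandsAt (f j) p t) :
      ExpandsAt (node f) ((∑ k ∈ Finset.Iio j, (f k).numLeaves) + p) (node (Function.update f j t))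

/-- `T` has a final caret whose first leaf is the one in position `p`. -/
def IsFinalCaret (T : NTree n) (p : ℕ) : Prop := ∃ T₀ : NTree n, T₀.ExpandsAt p T

/-- The number of final carets. -/
noncomputable def numFinalCarets (T : NTree n) : ℕ := {p | T.IsFinalCaret p}.ncard

end NTree

/-! ### Ribbons -/

/-- The pairs of strands that cross along a positive word `w` (the letter `i` is `σ_i`), listed
with repetitions; `s` tells which strand is in which position at the beginning. -/
def crossedPairs : List ℕ → (ℕ → ℕ) → List (Sym2 ℕ)
  | [], _ => []
  | i :: w, s => s(s i, s (i + 1)) :: crossedPairs w (s ∘ Equiv.swap i (i + 1))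

/-- The positive word `w` represents the braid `β`, and every pair of strands crosses at most
once along it. A braid is simple if it has such a word. -/
def IsSimpleWord (m : ℕ) (w : List ℕ) (β : BraidGroup m) : Prop :=
  BraidWord.IsValid m (w.map fun i => (i, true)) ∧
    BraidWord.toBraid m (w.map fun i => (i, true)) = β ∧ (crossedPairs w id).Nodup

/-- The strands of `β` that start in the positions `c, …, c + n - 1` form a trivial sub-braid
ending in the positions `c', …, c' + n - 1`: they lie in order in a tube that no other strand
meets, so `β` arises from a braid on `m₀ = m - n + 1` strands by replacing the strand from `c` to
`c'` by `n` parallel strands. -/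
def HasTrivialSubbraid (n : ℕ) {m : ℕ} (β : BraidGroup m) (c c' : ℕ) : Prop :=
  ∃ (m₀ : ℕ) (w : BraidWord) (p : Fin m₀), m₀ + n = m + 1 ∧ w.IsValid m₀ ∧ p.1 = c ∧
    ((w.toBraid m₀).perm p).1 = c' ∧ β = (w.cable n p.1).toBraid m

/-- `β` is the ribbon connecting the caret with first leaf `c` to the caret with first leaf `c'`:
it is of minimal length among the simple braids that contain a trivial sub-braid connecting the
leaves of the first caret to those of the second. -/
def IsRibbon (n : ℕ) {m : ℕ} (β : BraidGroup m) (c c' : ℕ) : Prop :=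
  HasTrivialSubbraid n β c c' ∧ ∃ w : List ℕ, IsSimpleWord m w β ∧
    ∀ (γ : BraidGroup m) (u : List ℕ), HasTrivialSubbraid n γ c c' → IsSimpleWord m u γ →
      w.length ≤ u.length

/-! ### The groups `BV_n(H)` -/

/-- A braided tree pair `(T, β, λ, T')` with `m` strands and labels in `H`. The label `label q`
sits at the lower end of the strand of `braid` that ends at the leaf of `ran` in position `q`. -/
structure BraidedTreePair (n : ℕ) (H : Subgroup (BraidGroup n)) (m : ℕ) where
  dom : NTree n
  braid : BraidGroup m
  label : Fin m → H
  ran : NTree n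
  dom_leaves : dom.numLeaves = m
  ran_leaves : ran.numLeaves = m

namespace BraidedTreePair

variable {n m k : ℕ} {H K : Subgroup (BraidGroup n)}

/-- `b` is obtained from `a` by expanding one strand, from the leaf `p` of the domain tree to the
leaf `q` of the range tree: both leaves receive a caret, the strand is replaced by `n` parallel
strands followed by the braid `h` given by its label, and the `n` new strands are
all labelled by `h`. -/
def IsExpansion (a : BraidedTreePair n H m) (b : BraidedTreePair n H k) : Prop :=
  ∃ (p q : Fin m) (w u : BraidWord),
    a.braid.perm p = q ∧
    a.dom.ExpandsAt p b.dom ∧ a.ran.ExpandsAt q b.ran ∧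
    w.IsValid m ∧ w.toBraid m = a.braid ∧
    u.IsValid n ∧ u.toBraid n = a.label q ∧
    b.braid = BraidWord.toBraid k (w.cable n p ++ u.shift q) ∧
    (∀ (i : Fin m) (j : Fin k), i < q → j.1 = i.1 → b.label j = a.label i) ∧
    (∀ j : Fin k, q.1 ≤ j.1 → j.1 < q.1 + n → b.label j = a.label q) ∧
    (∀ (i : Fin m) (j : Fin k), q < i → j.1 + 1 = i.1 + n → b.label j = a.label i)

/-- The composition `(T, β, λ, T') (T', β', λ', T'') = (T, β β', λ'', T'')`, in which the labels
met along each strand are multiplied. -/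
def comp (a b : BraidedTreePair n H m) (_h : a.ran = b.dom) : BraidedTreePair n H m where
  dom := a.dom
  braid := a.braid * b.braid
  label q := a.label (b.braid.perm.symm q) * b.label q
  ran := b.ran
  dom_leaves := a.dom_leaves
  ran_leaves := b.ran_leaves

/-- Enlarging the subgroup of labels. -/
def incl (h : H ≤ K) (a : BraidedTreePair n H m) : BraidedTreePair n K m where
  dom := a.dom
  braid := a.braid
  label q := Subgroup.inclusion h (a.label q)
  ran := a.ran
  dom_leaves := a.dom_leaves
  ran_leaves := a.ran_leaves

theorem IsExpansion.incl (h : H ≤ K) {a : BraidedTreePair n H m} {b : BraidedTreePair n H k}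
    (hab : a.IsExpansion b) : (a.incl h).IsExpansion (b.incl h) := by
  obtain ⟨p, q, w, u, h1, h2, h3, h4, h5, h6, h7, h8, h9, h10, h11⟩ := hab
  refine ⟨p, q, w, u, h1, h2, h3, h4, h5, h6, h7, h8, ?_, ?_, ?_⟩
  · intro i j hi hj
    exact congrArg (Subgroup.inclusion h) (h9 i j hi hj)
  · intro j hj hj'
    exact congrArg (Subgroup.inclusion h) (h10 j hj hj')
  · intro i j hi hj
    exact congrArg (Subgroup.inclusion h) (h11 i j hi hj)

end BraidedTreePair

/-- The set underlying `BV_n(H)`: braided tree pairs with labels in `H`, up to the equivalence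
relation generated by expansions. -/
def BV (n : ℕ) (H : Subgroup (BraidGroup n)) : Type :=
  Quot fun a b : (Σ m, BraidedTreePair n H m) => a.2.IsExpansion b.2

namespace BV

variable {n : ℕ} {H K : Subgroup (BraidGroup n)}

/-- The element represented by a braided tree pair. -/
def mk {m : ℕ} (a : BraidedTreePair n H m) : BV n H := Quot.mk _ ⟨m, a⟩

/-- The natural map `BV_n(H) → BV_n(K)` for `H ≤ K`. -/
def incl (h : H ≤ K) : BV n H → BV n K :=
  Quot.map (fun a => ⟨a.1, a.2.incl h⟩) fun _ _ hab => hab.incl h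

/-- The identity element, represented by trivial trees. -/
def one : BV n H := mk (m := 1) ⟨.leaf, 1, fun _ => 1, .leaf, rfl, rfl⟩

/-- `x y = z` in `BV_n(H)`: the elements `x` and `y` have representatives such that the range tree
of the first is the domain tree of the second, and whose composition represents `z`. -/
def IsMul (x y z : BV n H) : Prop :=
  ∃ (m : ℕ) (a b : BraidedTreePair n H m) (h : a.ran = b.dom),
    mk a = x ∧ mk b = y ∧ mk (a.comp b h) = z

/-- `z` is the product, in order, of a list of elements. -/
def IsProduct : List (BV n H) → BV n H → Prop
  | [], z => z = one
  | [x], z => z = x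
  | x :: y :: l, z => ∃ t, IsProduct (y :: l) t ∧ IsMul x t z

/-- The depth of an element: the least depth of the trees in a braided tree pair
representing it. -/
noncomputable def depth (x : BV n H) : ℕ :=
  sInf {d | ∃ (m : ℕ) (a : BraidedTreePair n H m), mk a = x ∧ a.dom.depth = d}

end BV

/-- The four kinds of factors `(T₁, β, λ, T₂)` attached to a tree `T₃`. -/
def IsElementaryFactor {n : ℕ} (T₃ : NTree n) (x : BV n ⊤) : Prop :=
  ∃ (m : ℕ) (t : BraidedTreePair n ⊤ m), BV.mk t = x ∧
    ((t.ran = T₃ ∧ t.label = 1 ∧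
        ∃ c c', t.dom.IsFinalCaret c ∧ t.ran.IsFinalCaret c' ∧ IsRibbon n t.braid c c') ∨
      (t.dom = T₃ ∧ t.label = 1 ∧
        ∃ c c', t.dom.IsFinalCaret c ∧ t.ran.IsFinalCaret c' ∧ IsRibbon n t.braid c c') ∨
      (t.dom = T₃ ∧ t.ran = T₃ ∧ t.label = 1 ∧
        ∃ i, t.braid = BraidGroup.sigma i ∨ t.braid = (BraidGroup.sigma i)⁻¹) ∨
      (t.dom = t.ran ∧ t.dom.depth = 1 ∧ t.braid = 1 ∧
        ∃ (i : Fin (n - 1)) (g : BraidGroup n),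
          (g = BraidGroup.sigma i ∨ g = (BraidGroup.sigma i)⁻¹) ∧
            ∀ q : Fin m, (t.label q : BraidGroup n) = if q.1 = 0 then g else 1))

/-!
The element of `(T, β, λ, T')` is the product of those of `(T, β, 1, T')` and `(T', 1, λ, T')`.
All factors are written with representatives on the same number of strands as `v`, so that a
composite of pairs represents the product of their classes without passing to common expansions
(`BraidedTreePair.IsComposite.exists_isProduct`). A pair with trivial labels whose braid contains a
tube joining two final carets represents an element of smaller depth, since both carets can be
removed (`BraidedTreePair.depth_mk_lt`).

*Braids.* For any two final carets there is a ribbon connecting them: moving a tube of `n` strands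
straight to its destination is a simple braid (`exists_isSimpleWord_hasTrivialSubbraid`), and among
the simple braids with this property there is one of minimal length. Since every nontrivial tree has
a final caret, there are ribbons `ρ` from `T` to `T₃` and `ρ'` from `T₃` to `T'`, and
`(T, β, 1, T') = (T, ρ, 1, T₃) (T₃, ρ⁻¹ β ρ'⁻¹, 1, T₃) (T₃, ρ', 1, T')`. The middle pair is a
product of Artin generators and their inverses on `T₃`. Distinct final carets have disjoint sets of
leaves, so one of the three final carets of `T₃` avoids the two strands that a given generator
crosses, and therefore each of these factors has depth less than `d` (`isComposite_ofBraid`).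

*Labels.* The labels of `(T', 1, λ, T')` multiply strand by strand, so it suffices to realize a
label on a single leaf of `T'`. Conjugation by a braid moves it to the first leaf of the tree that
has a chain of `d - 1` carets below the second child of its root; there all carets but the root
can be removed, and the label can be decomposed into generators of `𝓑_n` on the tree of depth one
(`isComposite_ofFirstLabel`, `isComposite_ofLabel`).
-/

/-! ### Permutations of braids -/

namespace BraidGroup

variable {m : ℕ}

theorem perm_one : (1 : BraidGroup m).perm = 1 := by
  simp [perm]

theorem perm_mul (β γ : BraidGroup m) : (β * γ).perm = γ.perm * β.perm := by
  simp [perm]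

theorem perm_inv (β : BraidGroup m) : (β⁻¹).perm = β.perm⁻¹ := by
  simp [perm]

theorem perm_sigma (i : Fin (m - 1)) : (sigma i).perm = adjacentSwap i := by
  simp [perm, permHom, sigma]

end BraidGroup

namespace BraidWord

variable {m : ℕ}

theorem toBraid_nil : toBraid m [] = 1 := rfl

theorem toBraid_cons (x : ℕ × Bool) (w : BraidWord) :
    toBraid m (x :: w) = letter m x * toBraid m w := by
  simp [toBraid]

theorem perm_letter (x : ℕ × Bool) (hx : x.1 + 1 < m) (p : Fin m) :
    ((letter m x).perm p).1 = Equiv.swap x.1 (x.1 + 1) p.1 := by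
  have hx' : x.1 < m - 1 := by omega
  have key : ((adjacentSwap (⟨x.1, hx'⟩ : Fin (m - 1))) p).1 = Equiv.swap x.1 (x.1 + 1) p.1 := by
    simp only [adjacentSwap, Equiv.swap_apply_def, Fin.ext_iff]
    split_ifs <;> rfl
  have hinv : (adjacentSwap (⟨x.1, hx'⟩ : Fin (m - 1)))⁻¹ = adjacentSwap ⟨x.1, hx'⟩ := by
    simp [adjacentSwap]
  rw [letter, dif_pos hx']
  split_ifs
  · rw [BraidGroup.perm_sigma, key]
  · rw [BraidGroup.perm_inv, BraidGroup.perm_sigma, hinv, key]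

theorem perm_toBraid_cons (x : ℕ × Bool) (w : BraidWord) (p : Fin m) :
    (toBraid m (x :: w)).perm p = (toBraid m w).perm ((letter m x).perm p) := by
  rw [toBraid_cons, BraidGroup.perm_mul, Equiv.Perm.mul_apply]

/-- The positive word moving the strand in position `p` to the right, past `L` strands. -/
def moveRight : ℕ → ℕ → BraidWord
  | _, 0 => []
  | p, L + 1 => (p, true) :: moveRight (p + 1) L

/-- The positive word moving the strand in position `q + L` to the left, to the position `q`. -/
def moveLeft (q : ℕ) : ℕ → BraidWord
  | 0 => []
  | L + 1 => (q + L, true) :: moveLeft q L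

theorem isValid_moveRight (p L : ℕ) (h : p + L < m) : (moveRight p L).IsValid m := by
  induction L generalizing p with
  | zero => simp [IsValid, moveRight]
  | succ L ih =>
    intro x hx
    rcases List.mem_cons.1 hx with rfl | hx
    · change p + 1 < m
      omega
    · exact ih (p + 1) (by omega) x hx

theorem isValid_moveLeft (q L : ℕ) (h : q + L < m) : (moveLeft q L).IsValid m := by
  induction L with
  | zero => simp [IsValid, moveLeft]
  | succ L ih =>
    intro x hx
    rcases List.mem_cons.1 hx with rfl | hx
    · exact h
    · exact ih (by omega) x hx

theorem perm_moveRight (p L : ℕ) (h : p + L < m) (i : Fin m) (hi : i.1 = p) :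
    (((moveRight p L).toBraid m).perm i).1 = p + L := by
  induction L generalizing p i with
  | zero => simp [moveRight, toBraid_nil, BraidGroup.perm_one, hi]
  | succ L ih =>
    rw [moveRight, perm_toBraid_cons, ih (p + 1) (by omega)]
    · omega
    · rw [perm_letter _ (by change p + 1 < m; omega), hi, Equiv.swap_apply_left]

theorem perm_moveLeft (q L : ℕ) (i : Fin m) (hi : i.1 = q + L) :
    (((moveLeft q L).toBraid m).perm i).1 = q := by
  induction L generalizing i with
  | zero => simp [moveLeft, toBraid_nil, BraidGroup.perm_one, hi]
  | succ L ih =>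
    have := i.2
    rw [moveLeft, perm_toBraid_cons, ih]
    rw [perm_letter _ (by change q + L + 1 < m; omega), hi]
    exact Equiv.swap_apply_right _ _

end BraidWord

/-! ### Existence of ribbons -/

/-- The strands in each position after the positive word `w`, if `s` tells which strand is in
which position before it. -/
def strandsAfter : List ℕ → (ℕ → ℕ) → ℕ → ℕ
  | [], s => s
  | i :: w, s => strandsAfter w (s ∘ Equiv.swap i (i + 1))

theorem crossedPairs_append (w u : List ℕ) (s : ℕ → ℕ) :
    crossedPairs (w ++ u) s = crossedPairs w s ++ crossedPairs u (strandsAfter w s) := by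
  induction w generalizing s with
  | nil => rfl
  | cons i w ih => simp [crossedPairs, strandsAfter, ih]

theorem strandsAfter_injective (w : List ℕ) (s : ℕ → ℕ) (hs : s.Injective) :
    (strandsAfter w s).Injective := by
  induction w generalizing s with
  | nil => exact hs
  | cons i w ih => exact ih _ (hs.comp (Equiv.injective _))

/-- The `n` strands in the positions `p, …, p + n - 1` pass over the strand in position `p + n`. -/
def tubeRight (n p : ℕ) : List ℕ := (List.range n).reverse.map fun k => p + k

/-- The `n` strands in the positions `p + 1, …, p + n` pass under the strand in position `p`. -/
def tubeLeft (n p : ℕ) : List ℕ := (List.range n).map fun k => p + k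

theorem tubeRight_succ (n p : ℕ) : tubeRight (n + 1) p = (p + n) :: tubeRight n p := by
  simp [tubeRight, List.range_succ]

theorem tubeLeft_succ (n p : ℕ) : tubeLeft (n + 1) p = p :: tubeLeft n (p + 1) := by
  simp [tubeLeft, List.range_succ_eq_map, Function.comp_def, add_assoc, add_comm 1]

theorem crossedPairs_tubeRight (n p : ℕ) (s : ℕ → ℕ) :
    crossedPairs (tubeRight n p) s =
      (List.range n).reverse.map fun k => s(s (p + k), s (p + n)) := by
  induction n generalizing s with
  | zero => rfl
  | succ n ih =>
    rw [tubeRight_succ, crossedPairs, ih, List.range_succ]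
    simp only [List.reverse_append, List.reverse_singleton, List.singleton_append, List.map_cons,
      List.cons.injEq]
    refine ⟨rfl, List.map_congr_left fun k hk => ?_⟩
    have hk : k < n := by simpa using hk
    simp only [Function.comp_apply, Equiv.swap_apply_left]
    rw [Equiv.swap_apply_of_ne_of_ne (by omega) (by omega), add_assoc]

theorem strandsAfter_tubeRight (n p : ℕ) (s : ℕ → ℕ) (x : ℕ) :
    strandsAfter (tubeRight n p) s x =
      if x = p then s (p + n) else if p < x ∧ x ≤ p + n then s (x - 1) else s x := by
  induction n generalizing s with
  | zero => simp [tubeRight, strandsAfter]; grind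
  | succ n ih =>
    rw [tubeRight_succ, strandsAfter, ih]
    simp only [Function.comp_apply, Equiv.swap_apply_def]
    grind

theorem crossedPairs_tubeLeft (n p : ℕ) (s : ℕ → ℕ) :
    crossedPairs (tubeLeft n p) s =
      (List.range n).map fun k => s(s p, s (p + 1 + k)) := by
  induction n generalizing s p with
  | zero => rfl
  | succ n ih =>
    rw [tubeLeft_succ, crossedPairs, ih, List.range_succ_eq_map]
    simp only [List.map_cons, List.map_map, List.cons.injEq]
    refine ⟨trivial, List.map_congr_left fun k _ => ?_⟩
    simp only [Function.comp_apply, Equiv.swap_apply_right]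
    rw [Equiv.swap_apply_of_ne_of_ne (by omega) (by omega),
      show p + 1 + 1 + k = p + 1 + k.succ by omega]

theorem strandsAfter_tubeLeft (n p : ℕ) (s : ℕ → ℕ) (x : ℕ) :
    strandsAfter (tubeLeft n p) s x =
      if x = p + n then s p else if p ≤ x ∧ x < p + n then s (x + 1) else s x := by
  induction n generalizing s p with
  | zero => simp [tubeLeft, strandsAfter]; grind
  | succ n ih =>
    rw [tubeLeft_succ, strandsAfter, ih]
    simp only [Function.comp_apply, Equiv.swap_apply_def]
    grind

/-- The word of the cable of `BraidWord.moveRight p L`. -/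
def cableRight (n : ℕ) : ℕ → ℕ → List ℕ
  | _, 0 => []
  | p, L + 1 => tubeRight n p ++ cableRight n (p + 1) L

/-- The word of the cable of `BraidWord.moveLeft q L`. -/
def cableLeft (n q : ℕ) : ℕ → List ℕ
  | 0 => []
  | L + 1 => tubeLeft n (q + L) ++ cableLeft n q L

theorem cable_moveRight (n p L : ℕ) :
    (BraidWord.moveRight p L).cable n p = (cableRight n p L).map fun i => (i, true) := by
  induction L generalizing p with
  | zero => rfl
  | succ L ih =>
    simp [BraidWord.moveRight, BraidWord.cable, cableRight, ih, BraidWord.cableLetter, tubeRight,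
      Function.comp_def]

theorem cable_moveLeft (n q L : ℕ) :
    (BraidWord.moveLeft q L).cable n (q + L) = (cableLeft n q L).map fun i => (i, true) := by
  induction L with
  | zero => rfl
  | succ L ih =>
    simp [BraidWord.moveLeft, BraidWord.cable, cableLeft, ih, BraidWord.cableLetter, tubeLeft,
      Function.comp_def, ← add_assoc]

theorem lt_of_mem_cableRight {n p L i : ℕ} (hi : i ∈ cableRight n p L) : i + 1 < p + L + n := by
  induction L generalizing p with
  | zero => simp [cableRight] at hi
  | succ L ih =>
    rcases List.mem_append.1 hi with hi | hi
    · simp only [tubeRight, List.mem_map, List.mem_reverse, List.mem_range] at hi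
      omega
    · have := ih hi
      omega

theorem lt_of_mem_cableLeft {n q L i : ℕ} (hi : i ∈ cableLeft n q L) : i + 1 < q + L + n := by
  induction L with
  | zero => simp [cableLeft] at hi
  | succ L ih =>
    rcases List.mem_append.1 hi with hi | hi
    · simp only [tubeLeft, List.mem_map, List.mem_range] at hi
      omega
    · have := ih hi
      omega

/-- A tube moving to the right crosses each of its strands with each of the strands it passes
exactly once. -/
theorem nodup_crossedPairs_cableRight (n p L : ℕ) (s : ℕ → ℕ) (hs : s.Injective) :
    (crossedPairs (cableRight n p L) s).Nodup ∧
      ∀ z ∈ crossedPairs (cableRight n p L) s, ∃ k < n, ∃ j < L,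
        z = s(s (p + k), s (p + n + j)) := by
  induction L generalizing p s with
  | zero => simp [cableRight, crossedPairs]
  | succ L ih =>
    obtain ⟨h1, h2⟩ := ih (p + 1) _ (strandsAfter_injective (tubeRight n p) s hs)
    have h3 : ∀ z ∈ crossedPairs (cableRight n (p + 1) L) (strandsAfter (tubeRight n p) s),
        ∃ k < n, ∃ j < L, z = s(s (p + k), s (p + n + (j + 1))) := by
      intro z hz
      obtain ⟨k, hk, j, hj, rfl⟩ := h2 z hz
      refine ⟨k, hk, j, hj, ?_⟩
      rw [strandsAfter_tubeRight, strandsAfter_tubeRight, if_neg (by omega), if_pos (by omega),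
        if_neg (by omega), if_neg (by omega), show p + 1 + k - 1 = p + k by omega,
        show p + 1 + n + j = p + n + (j + 1) by omega]
    rw [cableRight, crossedPairs_append, crossedPairs_tubeRight]
    refine ⟨List.nodup_append.2 ⟨?_, h1, ?_⟩, ?_⟩
    · refine (List.nodup_reverse.2 List.nodup_range).map fun k k' h => ?_
      have := Sym2.congr_left.1 h
      have := hs this
      omega
    · intro y hy z hz hyz
      simp only [List.mem_map, List.mem_reverse, List.mem_range] at hy
      obtain ⟨k, hk, rfl⟩ := hy
      obtain ⟨k', hk', j, hj, rfl⟩ := h3 z hz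
      rcases Sym2.eq_iff.1 hyz with ⟨_, h⟩ | ⟨h, _⟩
      · have := hs h
        omega
      · have := hs h
        omega
    · intro z hz
      rcases List.mem_append.1 hz with hz | hz
      · simp only [List.mem_map, List.mem_reverse, List.mem_range] at hz
        obtain ⟨k, hk, rfl⟩ := hz
        exact ⟨k, hk, 0, by omega, rfl⟩
      · obtain ⟨k, hk, j, hj, rfl⟩ := h3 z hz
        exact ⟨k, hk, j + 1, by omega, rfl⟩

theorem nodup_crossedPairs_cableLeft (n q L : ℕ) (s : ℕ → ℕ) (hs : s.Injective) :
    (crossedPairs (cableLeft n q L) s).Nodup ∧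
      ∀ z ∈ crossedPairs (cableLeft n q L) s, ∃ k < n, ∃ j < L,
        z = s(s (q + j), s (q + L + k)) := by
  induction L generalizing s with
  | zero => simp [cableLeft, crossedPairs]
  | succ L ih =>
    obtain ⟨h1, h2⟩ := ih _ (strandsAfter_injective (tubeLeft n (q + L)) s hs)
    have h3 : ∀ z ∈ crossedPairs (cableLeft n q L) (strandsAfter (tubeLeft n (q + L)) s),
        ∃ k < n, ∃ j < L, z = s(s (q + j), s (q + L + 1 + k)) := by
      intro z hz
      obtain ⟨k, hk, j, hj, rfl⟩ := h2 z hz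
      refine ⟨k, hk, j, hj, ?_⟩
      rw [strandsAfter_tubeLeft, strandsAfter_tubeLeft, if_neg (by omega), if_neg (by omega),
        if_neg (by omega), if_pos (by omega), show q + L + k + 1 = q + L + 1 + k by omega]
    rw [cableLeft, crossedPairs_append, crossedPairs_tubeLeft]
    refine ⟨List.nodup_append.2 ⟨?_, h1, ?_⟩, ?_⟩
    · refine List.nodup_range.map fun k k' h => ?_
      have := Sym2.congr_right.1 h
      have := hs this
      omega
    · intro y hy z hz hyz
      simp only [List.mem_map, List.mem_range] at hy
      obtain ⟨k, hk, rfl⟩ := hy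
      obtain ⟨k', hk', j, hj, rfl⟩ := h3 z hz
      rcases Sym2.eq_iff.1 hyz with ⟨h, _⟩ | ⟨h, _⟩
      · have := hs h
        omega
      · have := hs h
        omega
    · intro z hz
      rcases List.mem_append.1 hz with hz | hz
      · simp only [List.mem_map, List.mem_range] at hz
        obtain ⟨k, hk, rfl⟩ := hz
        exact ⟨k, hk, L, by omega, rfl⟩
      · obtain ⟨k, hk, j, hj, rfl⟩ := h3 z hz
        exact ⟨k, hk, j, by omega, rfl⟩

/-- A tube can be moved along a simple braid from any place to any other one. -/
theorem exists_isSimpleWord_hasTrivialSubbraid {n m c c' : ℕ} (hc : c + n ≤ m) (hc' : c' + n ≤ m) :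
    ∃ (γ : BraidGroup m) (u : List ℕ), HasTrivialSubbraid n γ c c' ∧ IsSimpleWord m u γ := by
  rcases le_total c c' with h | h
  · obtain ⟨L, rfl⟩ := Nat.exists_eq_add_of_le h
    refine ⟨_, cableRight n c L, ⟨m + 1 - n, BraidWord.moveRight c L, ⟨c, by omega⟩, by omega,
      BraidWord.isValid_moveRight _ _ (by omega), rfl,
      BraidWord.perm_moveRight _ _ (by omega) _ rfl, rfl⟩, ?_, ?_,
      (nodup_crossedPairs_cableRight n c L id Function.injective_id).1⟩
    · intro x hx
      obtain ⟨i, hi, rfl⟩ := List.mem_map.1 hx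
      exact (lt_of_mem_cableRight hi).trans_le hc'
    · rw [cable_moveRight]
  · obtain ⟨L, rfl⟩ := Nat.exists_eq_add_of_le h
    refine ⟨_, cableLeft n c' L, ⟨m + 1 - n, BraidWord.moveLeft c' L, ⟨c' + L, by omega⟩, by omega,
      BraidWord.isValid_moveLeft _ _ (by omega), rfl,
      BraidWord.perm_moveLeft _ _ _ rfl, rfl⟩, ?_, ?_,
      (nodup_crossedPairs_cableLeft n c' L id Function.injective_id).1⟩
    · intro x hx
      obtain ⟨i, hi, rfl⟩ := List.mem_map.1 hx
      exact (lt_of_mem_cableLeft hi).trans_le hc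
    · rw [cable_moveLeft]

theorem exists_isRibbon {n m c c' : ℕ} (hc : c + n ≤ m) (hc' : c' + n ≤ m) :
    ∃ ρ : BraidGroup m, IsRibbon n ρ c c' := by
  classical
  let S : Set ℕ := {l | ∃ (γ : BraidGroup m) (u : List ℕ),
    HasTrivialSubbraid n γ c c' ∧ IsSimpleWord m u γ ∧ u.length = l}
  have hS : S.Nonempty := by
    obtain ⟨γ, u, h1, h2⟩ := exists_isSimpleWord_hasTrivialSubbraid hc hc'
    exact ⟨u.length, γ, u, h1, h2, rfl⟩
  obtain ⟨ρ, w, h1, h2, h3⟩ := Nat.sInf_mem hS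
  exact ⟨ρ, h1, w, h2, fun γ u hγ hu => h3 ▸ Nat.sInf_le ⟨γ, u, hγ, hu, rfl⟩⟩

/-- An Artin generator or its inverse contains every tube that avoids its two positions. -/
theorem hasTrivialSubbraid_letter {n m p : ℕ} (hn : 0 < n) (x : ℕ × Bool) (hx : x.1 + 1 < m)
    (hp : p + n ≤ m) (h : x.1 + 1 < p ∨ p + n ≤ x.1) :
    HasTrivialSubbraid n (BraidWord.letter m x) p p := by
  rcases h with h | h
  · refine ⟨m + 1 - n, [x], ⟨p, by omega⟩, by omega, ?_, rfl, ?_, ?_⟩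
    · simp only [BraidWord.IsValid, List.mem_singleton, forall_eq]
      omega
    · rw [BraidWord.perm_toBraid_cons, BraidWord.toBraid_nil, BraidGroup.perm_one,
        Equiv.Perm.one_apply, BraidWord.perm_letter _ (by omega)]
      exact Equiv.swap_apply_of_ne_of_ne (by simp; omega) (by simp; omega)
    · simp [BraidWord.cable, BraidWord.cableLetter, h, BraidWord.toBraid]
  · -- The crossing lies to the right of the tube, which shifts it by `n - 1`.
    refine ⟨m + 1 - n, [(x.1 + 1 - n, x.2)], ⟨p, by omega⟩, by omega, ?_, rfl, ?_, ?_⟩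
    · simp only [BraidWord.IsValid, List.mem_singleton, forall_eq]
      omega
    · rw [BraidWord.perm_toBraid_cons, BraidWord.toBraid_nil, BraidGroup.perm_one,
        Equiv.Perm.one_apply, BraidWord.perm_letter _ (by simp; omega)]
      exact Equiv.swap_apply_of_ne_of_ne (by simp; omega) (by simp; omega)
    · have h1 : ¬ x.1 + 1 - n + 1 < p := by omega
      have h2 : ¬ x.1 + 1 - n + 1 = p := by omega
      have h3 : ¬ x.1 + 1 - n = p := by omega
      have h4 : x.1 + 1 - n + n - 1 = x.1 := by omega
      simp [BraidWord.cable, BraidWord.cableLetter, h1, h2, h3, h4, BraidWord.toBraid]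

/-! ### Trees and their final carets -/

namespace NTree

variable {n : ℕ}

theorem sum_update_children (g : NTree n → ℕ) (f : Fin n → NTree n) (j : Fin n) (t : NTree n) :
    ∑ i, g (Function.update f j t i) + g (f j) = ∑ i, g (f i) + g t := by
  rw [← Finset.add_sum_erase _ _ (Finset.mem_univ j),
    ← Finset.add_sum_erase (a := j) _ (fun i => g (f i)) (Finset.mem_univ j),
    Finset.sum_congr rfl fun i hi => by rw [Function.update_of_ne (Finset.ne_of_mem_erase hi)]]
  simp only [Function.update_self]
  omega

theorem sum_Iio_add_le_sum_Iio (g : Fin n → ℕ) {i j : Fin n} (h : i < j) :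
    ∑ k ∈ Finset.Iio i, g k + g i ≤ ∑ k ∈ Finset.Iio j, g k := by
  rw [add_comm, ← Finset.sum_insert (f := g) (by simp)]
  refine Finset.sum_le_sum_of_subset fun k hk => ?_
  simp only [Finset.mem_insert, Finset.mem_Iio] at hk ⊢
  rcases hk with rfl | hk
  · exact h
  · exact hk.trans h

theorem sum_Iio_add_le_sum (g : Fin n → ℕ) (i : Fin n) :
    ∑ k ∈ Finset.Iio i, g k + g i ≤ ∑ k, g k := by
  rw [add_comm, ← Finset.sum_insert (f := g) (by simp)]
  exact Finset.sum_le_sum_of_subset (Finset.subset_univ _)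

theorem numLeaves_add_depth (T : NTree n) : T.numLeaves + T.depth = 1 + n * T.depth := by
  induction T with
  | leaf => simp [numLeaves, depth]
  | node f ih =>
    have := Finset.sum_congr (rfl : (Finset.univ : Finset (Fin n)) = _) fun i _ => ih i
    simp only [Finset.sum_add_distrib, ← Finset.mul_sum] at this
    simp only [Finset.sum_const, Finset.card_univ, Fintype.card_fin, smul_eq_mul, mul_one] at this
    simp only [numLeaves, depth]
    linarith

theorem depth_eq_of_numLeaves_eq (hn : 2 ≤ n) {T T' : NTree n} (h : T.numLeaves = T'.numLeaves) :
    T.depth = T'.depth := by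
  have h1 := T.numLeaves_add_depth
  have h2 := T'.numLeaves_add_depth
  obtain ⟨k, rfl⟩ := Nat.exists_eq_add_of_le hn
  have : (1 + k) * T.depth = (1 + k) * T'.depth := by linarith
  exact Nat.eq_of_mul_eq_mul_left (by omega) this

theorem numLeaves_eq_of_depth_eq {T T' : NTree n} (h : T.depth = T'.depth) :
    T.numLeaves = T'.numLeaves := by
  have h1 := T.numLeaves_add_depth
  have h2 := T'.numLeaves_add_depth
  rw [← h] at h2
  omega

theorem ExpandsAt.numLeaves_eq {T T' : NTree n} {p : ℕ} (h : T.ExpandsAt p T') :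
    T'.numLeaves + 1 = T.numLeaves + n := by
  induction h with
  | leaf => simp [numLeaves, add_comm]
  | node f j p t h ih =>
    have := sum_update_children numLeaves f j t
    simp only [numLeaves]
    omega

theorem ExpandsAt.depth_eq {T T' : NTree n} {p : ℕ} (h : T.ExpandsAt p T') :
    T'.depth = T.depth + 1 := by
  induction h with
  | leaf => simp [depth]
  | node f j p t h ih =>
    have := sum_update_children depth f j t
    simp only [depth]
    omega

theorem ExpandsAt.lt_numLeaves {T T' : NTree n} {p : ℕ} (h : T.ExpandsAt p T') :
    p < T.numLeaves := by
  induction h with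
  | leaf => simp [numLeaves]
  | node f j p t h ih =>
    have := sum_Iio_add_le_sum (fun k => (f k).numLeaves) j
    simp only [numLeaves]
    omega

theorem IsFinalCaret.add_le_numLeaves {T : NTree n} {p : ℕ} (h : T.IsFinalCaret p) :
    p + n ≤ T.numLeaves := by
  obtain ⟨T₀, h⟩ := h
  have h1 := h.numLeaves_eq
  have h2 := h.lt_numLeaves
  omega

theorem not_isFinalCaret_leaf (p : ℕ) : ¬ (leaf : NTree n).IsFinalCaret p := by
  rintro ⟨T₀, h⟩
  cases h

theorem isFinalCaret_node {f : Fin n → NTree n} {p : ℕ} :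
    (node f).IsFinalCaret p ↔ (p = 0 ∧ f = fun _ => leaf) ∨
      ∃ j q, (f j).IsFinalCaret q ∧ p = ∑ k ∈ Finset.Iio j, (f k).numLeaves + q := by
  constructor
  · rintro ⟨T₀, h⟩
    cases h with
    | leaf => exact .inl ⟨rfl, rfl⟩
    | node f j p t h =>
      refine .inr ⟨j, p, ?_, ?_⟩
      · rw [Function.update_self]
        exact ⟨_, h⟩
      · congr 1
        refine Finset.sum_congr rfl fun k hk => ?_
        rw [Function.update_of_ne (Finset.mem_Iio.1 hk).ne]
  · rintro (⟨rfl, rfl⟩ | ⟨j, q, ⟨t, h⟩, rfl⟩)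
    · exact ⟨leaf, .leaf⟩
    · have := ExpandsAt.node (Function.update f j t) j q (f j) (by rwa [Function.update_self])
      rw [Function.update_idem, Function.update_eq_self] at this
      refine ⟨node (Function.update f j t), ?_⟩
      convert this using 2
      refine Finset.sum_congr rfl fun k hk => ?_
      rw [Function.update_of_ne (Finset.mem_Iio.1 hk).ne]

theorem exists_isFinalCaret (T : NTree n) (h : 0 < T.depth) : ∃ p, T.IsFinalCaret p := by
  induction T with
  | leaf => simp [depth] at h
  | node f ih =>
    by_cases hf : f = fun _ => leaf
    · exact ⟨0, isFinalCaret_node.2 (.inl ⟨rfl, hf⟩)⟩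
    · obtain ⟨j, hj⟩ := Function.ne_iff.1 hf
      have : 0 < (f j).depth := by
        cases e : f j with
        | leaf => exact absurd e hj
        | node g => simp [depth]
      obtain ⟨q, hq⟩ := ih j this
      exact ⟨_, isFinalCaret_node.2 (.inr ⟨j, q, hq, rfl⟩)⟩

/-- Distinct final carets have disjoint sets of leaves. -/
theorem IsFinalCaret.add_le_of_lt {T : NTree n} {p q : ℕ} (hp : T.IsFinalCaret p)
    (hq : T.IsFinalCaret q) (h : p < q) : p + n ≤ q := by
  induction T generalizing p q with
  | leaf => exact absurd hp (not_isFinalCaret_leaf p)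
  | node f ih =>
    rcases isFinalCaret_node.1 hp with ⟨rfl, hf⟩ | ⟨i, a, ha, rfl⟩
    · rcases isFinalCaret_node.1 hq with ⟨rfl, -⟩ | ⟨j, b, hb, rfl⟩
      · omega
      · rw [hf] at hb
        exact absurd hb (not_isFinalCaret_leaf b)
    · rcases isFinalCaret_node.1 hq with ⟨rfl, -⟩ | ⟨j, b, hb, rfl⟩
      · omega
      · have h1 := ha.add_le_numLeaves
        have h2 := hb.add_le_numLeaves
        rcases lt_trichotomy i j with hij | rfl | hij
        · have := sum_Iio_add_le_sum_Iio (fun k => (f k).numLeaves) hij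
          omega
        · have := ih i ha hb (by omega)
          omega
        · have := sum_Iio_add_le_sum_Iio (fun k => (f k).numLeaves) hij
          omega

/-- Two adjacent leaves meet at most two final carets. -/
theorem exists_isFinalCaret_avoiding (hn : 0 < n) {T : NTree n} (h : T.numFinalCarets = 3)
    (i : ℕ) : ∃ p, T.IsFinalCaret p ∧ (i + 1 < p ∨ p + n ≤ i) := by
  obtain ⟨a, b, c, hab, hac, hbc, he⟩ := Set.ncard_eq_three.1 h
  have ha : T.IsFinalCaret a := he.ge (by simp)
  have hb : T.IsFinalCaret b := he.ge (by simp)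
  have hc : T.IsFinalCaret c := he.ge (by simp)
  have key : ∀ {p q}, T.IsFinalCaret p → T.IsFinalCaret q → p ≠ q → p + n ≤ q ∨ q + n ≤ p :=
    fun hp hq hpq => hpq.lt_or_gt.imp (hp.add_le_of_lt hq) (hq.add_le_of_lt hp)
  have h1 := key ha hb hab
  have h2 := key ha hc hac
  have h3 := key hb hc hbc
  by_contra! H
  have h4 := H a ha
  have h5 := H b hb
  have h6 := H c hc
  omega

/-! ### Trees built by forks -/

/-- The caret with `A` attached to its first leaf and `B` attached to its second leaf. -/
def fork (A B : NTree n) : NTree n :=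
  node fun j => if j.1 = 0 then A else if j.1 = 1 then B else leaf

theorem sum_Iio_zero (hn : 2 ≤ n) (g : Fin n → ℕ) :
    ∑ k ∈ Finset.Iio (⟨0, by omega⟩ : Fin n), g k = 0 := by
  refine Finset.sum_eq_zero fun k hk => ?_
  simp [Fin.lt_def] at hk

theorem sum_Iio_one (hn : 2 ≤ n) (g : Fin n → ℕ) :
    ∑ k ∈ Finset.Iio (⟨1, by omega⟩ : Fin n), g k = g ⟨0, by omega⟩ := by
  have : Finset.Iio (⟨1, by omega⟩ : Fin n) = {⟨0, by omega⟩} := by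
    ext k
    simp [Fin.lt_def, Fin.ext_iff]
  rw [this, Finset.sum_singleton]

theorem depth_fork (hn : 2 ≤ n) (A B : NTree n) : (fork A B).depth = 1 + A.depth + B.depth := by
  obtain ⟨k, rfl⟩ := Nat.exists_eq_add_of_le' hn
  simp [fork, depth, Fin.sum_univ_succ, add_assoc]

theorem fork_leaf_leaf : fork leaf leaf = (node fun _ => leaf : NTree n) := by
  simp [fork]

theorem isFinalCaret_fork (hn : 2 ≤ n) {A B : NTree n} (h : 0 < A.depth + B.depth) {p : ℕ} :
    (fork A B).IsFinalCaret p ↔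
      A.IsFinalCaret p ∨ ∃ q, B.IsFinalCaret q ∧ A.numLeaves + q = p := by
  rw [fork, isFinalCaret_node]
  constructor
  · rintro (⟨-, hf⟩ | ⟨j, q, hq, rfl⟩)
    · have h0 := congrFun hf ⟨0, by omega⟩
      have h1 := congrFun hf ⟨1, by omega⟩
      simp only [if_true, one_ne_zero, if_false] at h0 h1
      simp [h0, h1, depth] at h
    · by_cases hj0 : j = ⟨0, by omega⟩
      · subst hj0
        rw [sum_Iio_zero hn]
        simp only [if_true] at hq
        simpa using Or.inl hq
      · by_cases hj1 : j = ⟨1, by omega⟩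
        · subst hj1
          rw [sum_Iio_one hn]
          simp only [one_ne_zero, if_true, if_false] at hq ⊢
          exact .inr ⟨q, hq, rfl⟩
        · rw [Fin.ext_iff] at hj0 hj1
          rw [if_neg hj0, if_neg hj1] at hq
          exact absurd hq (not_isFinalCaret_leaf q)
  · rintro (hp | ⟨q, hq, rfl⟩)
    · exact .inr ⟨⟨0, by omega⟩, p, by simpa using hp, by rw [sum_Iio_zero hn, zero_add]⟩
    · exact .inr ⟨⟨1, by omega⟩, q, by simpa using hq, by rw [sum_Iio_one hn]; simp⟩

theorem numFinalCarets_leaf : (leaf : NTree n).numFinalCarets = 0 := by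
  simp [numFinalCarets, not_isFinalCaret_leaf]

theorem numFinalCarets_caret : (node fun _ => leaf : NTree n).numFinalCarets = 1 := by
  rw [numFinalCarets, Set.ncard_eq_one]
  refine ⟨0, Set.ext fun p => ?_⟩
  simp [isFinalCaret_node, not_isFinalCaret_leaf]

theorem finite_setOf_isFinalCaret (T : NTree n) : {p | T.IsFinalCaret p}.Finite :=
  (Set.finite_Iic T.numLeaves).subset fun _ hp =>
    (Nat.le_add_right _ _).trans (IsFinalCaret.add_le_numLeaves hp)

theorem numFinalCarets_fork (hn : 2 ≤ n) {A B : NTree n} (h : 0 < A.depth + B.depth) :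
    (fork A B).numFinalCarets = A.numFinalCarets + B.numFinalCarets := by
  have : {p | (fork A B).IsFinalCaret p} =
      {p | A.IsFinalCaret p} ∪ (fun q => A.numLeaves + q) '' {q | B.IsFinalCaret q} := by
    ext p
    simp only [Set.mem_ofPred_eq, Set.mem_union, Set.mem_image]
    exact isFinalCaret_fork hn h
  rw [numFinalCarets, this, Set.ncard_union_eq _ (finite_setOf_isFinalCaret A)
    ((finite_setOf_isFinalCaret B).image _),
    Set.ncard_image_of_injective _ (add_right_injective _), numFinalCarets, numFinalCarets]
  rw [Set.disjoint_left]
  rintro _ hp ⟨q, -, rfl⟩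
  have := IsFinalCaret.add_le_numLeaves hp
  dsimp only at this
  omega

/-- The tree with `k` carets, each attached to the first leaf of the previous one. -/
def chain : ℕ → NTree n
  | 0 => leaf
  | k + 1 => fork (chain k) leaf

theorem depth_chain (hn : 2 ≤ n) (k : ℕ) : (chain k : NTree n).depth = k := by
  induction k with
  | zero => rfl
  | succ k ih =>
    rw [chain, depth_fork hn, ih]
    simp [depth, add_comm]

theorem numFinalCarets_chain_succ (hn : 2 ≤ n) (k : ℕ) :
    (chain (k + 1) : NTree n).numFinalCarets = 1 := by
  induction k with
  | zero => rw [chain, chain, fork_leaf_leaf, numFinalCarets_caret]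
  | succ k ih =>
    rw [chain, numFinalCarets_fork hn, ih, numFinalCarets_leaf]
    rw [depth_chain hn]
    omega

theorem exists_numFinalCarets_eq_three (hn : 2 ≤ n) {d : ℕ} (hd : 4 < d) :
    ∃ T : NTree n, T.depth = d ∧ T.numFinalCarets = 3 := by
  obtain ⟨k, rfl⟩ := Nat.exists_eq_add_of_lt hd
  refine ⟨fork (fork (chain 1) (chain 1)) (chain (k + 1)), ?_, ?_⟩
  · rw [depth_fork hn, depth_fork hn, depth_chain hn, depth_chain hn]
    omega
  · rw [numFinalCarets_fork hn, numFinalCarets_fork hn, numFinalCarets_chain_succ hn,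
      numFinalCarets_chain_succ hn]
    · simp [depth_chain hn]
    · simp [depth_chain hn]

theorem ExpandsAt.fork_left (hn : 2 ≤ n) {A A' : NTree n} {p : ℕ} (h : A.ExpandsAt p A')
    (B : NTree n) : (fork A B).ExpandsAt p (fork A' B) := by
  have := ExpandsAt.node (fun j : Fin n => if j.1 = 0 then A else if j.1 = 1 then B else NTree.leaf)
    ⟨0, by omega⟩ p A' (by simpa using h)
  rw [sum_Iio_zero hn, zero_add] at this
  have he : fork A' B = NTree.node (Function.update (fun j : Fin n => if j.1 = 0 then A else
      if j.1 = 1 then B else NTree.leaf) ⟨0, by omega⟩ A') := by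
    rw [fork]
    congr 1
    funext j
    by_cases hj : j.1 = 0 <;> simp [Function.update_apply, Fin.ext_iff, hj]
  rw [he]
  exact this

theorem ExpandsAt.fork_right (hn : 2 ≤ n) {B B' : NTree n} {p : ℕ} (h : B.ExpandsAt p B')
    (A : NTree n) : (fork A B).ExpandsAt (A.numLeaves + p) (fork A B') := by
  have := ExpandsAt.node (fun j : Fin n => if j.1 = 0 then A else if j.1 = 1 then B else NTree.leaf)
    ⟨1, by omega⟩ p B' (by simpa using h)
  rw [sum_Iio_one hn] at this
  simp only [if_true] at this
  have he : fork A B' = NTree.node (Function.update (fun j : Fin n => if j.1 = 0 then A else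
      if j.1 = 1 then B else NTree.leaf) ⟨1, by omega⟩ B') := by
    rw [fork]
    congr 1
    funext j
    by_cases hj : j.1 = 1 <;> simp [Function.update_apply, Fin.ext_iff, hj]
  rw [he]
  exact this

theorem expandsAt_chain (hn : 2 ≤ n) (k : ℕ) : (chain k : NTree n).ExpandsAt 0 (chain (k + 1)) := by
  induction k with
  | zero =>
    rw [chain, chain, chain, fork_leaf_leaf]
    exact .leaf
  | succ k ih => exact ih.fork_left hn leaf

end NTree

/-! ### Composites of braided tree pairs -/

namespace BraidedTreePair

variable {n m : ℕ} {K : Subgroup (BraidGroup n)}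

theorem comp_assoc (a b c : BraidedTreePair n K m) (hab : a.ran = b.dom) (hbc : b.ran = c.dom) :
    (a.comp b hab).comp c hbc = a.comp (b.comp c hbc) hab := by
  simp only [comp, mk.injEq, true_and, and_true]
  refine ⟨mul_assoc _ _ _, funext fun q => ?_⟩
  rw [BraidGroup.perm_mul, mul_assoc]
  rfl

/-- `a` is a composite of finitely many, and at least one, braided tree pairs on the same number
of strands that satisfy `P`. -/
inductive IsComposite (P : BraidedTreePair n K m → Prop) : BraidedTreePair n K m → Prop
  | of {a : BraidedTreePair n K m} (ha : P a) : IsComposite P a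
  | cons {a b : BraidedTreePair n K m} (h : a.ran = b.dom) (ha : P a) (hb : IsComposite P b) :
      IsComposite P (a.comp b h)

theorem IsComposite.comp {P : BraidedTreePair n K m → Prop} {a b : BraidedTreePair n K m}
    (ha : IsComposite P a) (hb : IsComposite P b) (h : a.ran = b.dom) :
    IsComposite P (a.comp b h) := by
  induction ha with
  | of ha => exact .cons h ha hb
  | @cons a c h' ha _ ih =>
    exact (congrArg (IsComposite P) (comp_assoc a c b h' h)).mpr
      (.cons (a := a) (b := c.comp b h) h' ha (ih h))

/-- Because all representatives of a composite have the same number of strands, no common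
expansions are needed to see its class as a product. -/
theorem IsComposite.exists_isProduct {P : BraidedTreePair n K m → Prop}
    {a : BraidedTreePair n K m} (ha : IsComposite P a) :
    ∃ l : List (BV n K), l ≠ [] ∧ BV.IsProduct l (BV.mk a) ∧ ∀ x ∈ l, ∃ b, P b ∧ BV.mk b = x := by
  induction ha with
  | @of a ha => exact ⟨[BV.mk a], by simp, rfl, by simpa using ⟨a, ha, rfl⟩⟩
  | @cons a b h ha _ ih =>
    obtain ⟨l, hl, hp, hx⟩ := ih
    obtain ⟨y, l, rfl⟩ := List.exists_cons_of_ne_nil hl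
    refine ⟨BV.mk a :: y :: l, by simp, ⟨BV.mk b, hp, m, a, b, h, rfl, rfl, rfl⟩, fun x h => ?_⟩
    rcases List.mem_cons.1 h with rfl | h
    · exact ⟨a, ha, rfl⟩
    · exact hx x h

/-- The braided tree pair `(T, β, 1, T')` with trivial labels. -/
def ofBraid (T T' : NTree n) (hT : T.numLeaves = m) (hT' : T'.numLeaves = m) (β : BraidGroup m) :
    BraidedTreePair n K m :=
  ⟨T, β, 1, T', hT, hT'⟩

/-- The braided tree pair `(T, 1, l, T)` with trivial braid. -/
def ofLabel (T : NTree n) (hT : T.numLeaves = m) (l : Fin m → K) : BraidedTreePair n K m :=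
  ⟨T, 1, l, T, hT, hT⟩

theorem ofBraid_comp_ofBraid {T T' T'' : NTree n} (hT : T.numLeaves = m) (hT' : T'.numLeaves = m)
    (hT'' : T''.numLeaves = m) (β γ : BraidGroup m) :
    (ofBraid T T' hT hT' β).comp (ofBraid T' T'' hT' hT'' γ) rfl =
      (ofBraid T T'' hT hT'' (β * γ) : BraidedTreePair n K m) := by
  simp only [comp, ofBraid, mk.injEq, true_and, and_true]
  funext q
  exact mul_one 1

theorem ofBraid_comp_ofLabel {T T' : NTree n} (hT : T.numLeaves = m) (hT' : T'.numLeaves = m)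
    (β : BraidGroup m) (l : Fin m → K) :
    (ofBraid T T' hT hT' β).comp (ofLabel T' hT' l) rfl = ⟨T, β, l, T', hT, hT'⟩ := by
  simp only [comp, ofBraid, ofLabel, mk.injEq, true_and, and_true]
  refine ⟨mul_one β, funext fun q => ?_⟩
  exact one_mul (l q)

theorem ofLabel_comp_ofLabel {T : NTree n} (hT : T.numLeaves = m) (l l' : Fin m → K) :
    (ofLabel T hT l).comp (ofLabel T hT l') rfl = ofLabel T hT (l * l') := by
  simp only [comp, ofLabel, mk.injEq, true_and, and_true]
  refine ⟨mul_one 1, funext fun q => ?_⟩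
  rw [BraidGroup.perm_one]
  rfl

/-- Conjugating by a braid moves the labels along its strands. -/
theorem ofBraid_comp_ofLabel_comp_ofBraid {T T' : NTree n} (hT : T.numLeaves = m)
    (hT' : T'.numLeaves = m) (γ : BraidGroup m) (l : Fin m → K) :
    ((ofBraid T T' hT hT' γ).comp (ofLabel T' hT' l) rfl).comp (ofBraid T' T hT' hT γ⁻¹) rfl =
      ofLabel T hT (l ∘ γ.perm) := by
  simp only [comp, ofBraid, ofLabel, mk.injEq, true_and, and_true, mul_one, mul_inv_cancel]
  funext q
  rw [BraidGroup.perm_inv]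
  exact (mul_one _).trans (one_mul _)

/-- A trivial sub-braid that connects two final carets allows both carets to be removed. -/
theorem depth_mk_lt {t : BraidedTreePair n K m} {c c' : ℕ} (hl : t.label = 1)
    (hc : t.dom.IsFinalCaret c) (hc' : t.ran.IsFinalCaret c')
    (h : HasTrivialSubbraid n t.braid c c') : (BV.mk t).depth < t.dom.depth := by
  obtain ⟨T, hT⟩ := hc
  obtain ⟨T', hT'⟩ := hc'
  obtain ⟨m₀, w, p, hm, hw, rfl, rfl, hβ⟩ := h
  have h1 := hT.numLeaves_eq
  have h2 := hT'.numLeaves_eq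
  have h3 := t.dom_leaves
  have h4 := t.ran_leaves
  let a : BraidedTreePair n K m₀ :=
    ofBraid T T' (by omega) (by omega) (w.toBraid m₀)
  have ha : a.IsExpansion t := by
    refine ⟨p, _, w, [], rfl, hT, hT', hw, rfl, by simp [BraidWord.IsValid], rfl, ?_, ?_, ?_, ?_⟩
    · simpa [BraidWord.shift] using hβ
    · intro i j _ _
      rw [hl]
      rfl
    · intro j _ _
      rw [hl]
      rfl
    · intro i j _ _
      rw [hl]
      rfl
  have hle : (BV.mk t).depth ≤ T.depth := Nat.sInf_le ⟨m₀, a, Quot.sound ha, rfl⟩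
  have := hT.depth_eq
  omega

theorem depth_mk_le (t : BraidedTreePair n K m) : (BV.mk t).depth ≤ t.dom.depth :=
  Nat.sInf_le ⟨m, t, rfl, rfl⟩

/-- The braided tree pair `(T, 1, (g, 1, …, 1), T)`. -/
def ofFirstLabel (T : NTree n) (g : K) : BraidedTreePair n K T.numLeaves :=
  ofLabel T rfl fun q => if q.1 = 0 then g else 1

/-- Carets may be appended away from the only labelled strand without changing the braid or the
labels. -/
theorem mk_ofFirstLabel_eq_of_expandsAt {T T' : NTree n} {p : ℕ} (h : T.ExpandsAt p T')
    (hp : 0 < p) (g : K) : BV.mk (ofFirstLabel T g) = BV.mk (ofFirstLabel T' g) := by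
  refine Quot.sound ⟨⟨p, h.lt_numLeaves⟩, ⟨p, h.lt_numLeaves⟩, [], [], ?_, h, h,
    by simp [BraidWord.IsValid], rfl, by simp [BraidWord.IsValid], ?_, rfl, ?_, ?_, ?_⟩
  · change (1 : BraidGroup _).perm _ = _
    rw [BraidGroup.perm_one, Equiv.Perm.one_apply]
  · simp [ofFirstLabel, ofLabel, BraidWord.toBraid_nil, hp.ne']
  · intro i j _ hj
    simp [ofFirstLabel, ofLabel, hj]
  · intro j hj _
    have : j.1 ≠ 0 := by
      simp only at hj
      omega
    simp [ofFirstLabel, ofLabel, this, hp.ne']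
  · intro i j hi hj
    rw [Fin.lt_def] at hi
    simp only at hi
    have h1 : i.1 ≠ 0 := by omega
    have h2 : j.1 ≠ 0 := by omega
    simp [ofFirstLabel, ofLabel, h1, h2]

/-- A label on the first leaf of a tree that has carets only below the second child of its root can
be carried by the tree of depth one. -/
theorem mk_ofFirstLabel_fork (hn : 2 ≤ n) (k : ℕ) (g : K) :
    BV.mk (ofFirstLabel (NTree.fork .leaf (NTree.chain k)) g) =
      BV.mk (ofFirstLabel (NTree.fork .leaf .leaf) g) := by
  induction k with
  | zero => rfl
  | succ k ih =>
    rw [← ih]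
    have h := (NTree.expandsAt_chain hn k).fork_right hn .leaf
    refine (mk_ofFirstLabel_eq_of_expandsAt h ?_ g).symm
    simp [NTree.numLeaves]

end BraidedTreePair

/-! ### Elementary factors -/

open BraidedTreePair

/-- The pair `a` represents an elementary factor of depth less than `d`. -/
def RepresentsFactor {n m : ℕ} (T₃ : NTree n) (d : ℕ) (a : BraidedTreePair n ⊤ m) : Prop :=
  (BV.mk a).depth < d ∧ IsElementaryFactor T₃ (BV.mk a)

section Factors

variable {n m d : ℕ} {T₃ : NTree n}

theorem representsFactor_ofBraid_letter (hn : 2 ≤ n) (hd : T₃.depth = d)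
    (h₃ : T₃.numFinalCarets = 3) (hT₃ : T₃.numLeaves = m) (x : ℕ × Bool) (hx : x.1 + 1 < m) :
    RepresentsFactor T₃ d (ofBraid T₃ T₃ hT₃ hT₃ (BraidWord.letter m x)) := by
  obtain ⟨p, hp, hpx⟩ := NTree.exists_isFinalCaret_avoiding (by omega) h₃ x.1
  refine ⟨?_, m, _, rfl, .inr (.inr (.inl ⟨rfl, rfl, rfl, ⟨x.1, by omega⟩, ?_⟩))⟩
  · rw [← hd]
    exact depth_mk_lt rfl hp hp
      (hasTrivialSubbraid_letter (by omega) x hx (hT₃ ▸ hp.add_le_numLeaves) hpx)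
  · change BraidWord.letter m x = _ ∨ BraidWord.letter m x = _
    rw [BraidWord.letter, dif_pos (by omega)]
    split_ifs
    · exact .inl rfl
    · exact .inr rfl

/-- Braids on the strands of `T₃` are products of Artin generators and their inverses. -/
theorem isComposite_ofBraid_self (hn : 2 ≤ n) (hd : T₃.depth = d) (h₃ : T₃.numFinalCarets = 3)
    (hT₃ : T₃.numLeaves = m) (β : BraidGroup m) :
    IsComposite (RepresentsFactor T₃ d) (ofBraid T₃ T₃ hT₃ hT₃ β) := by
  have hm : 2 ≤ m := by
    obtain ⟨p, hp, -⟩ := NTree.exists_isFinalCaret_avoiding (by omega) h₃ 0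
    have := hp.add_le_numLeaves
    omega
  have hlet : ∀ (i : Fin (m - 1)) (b : Bool),
      IsComposite (RepresentsFactor T₃ d) (ofBraid T₃ T₃ hT₃ hT₃ (BraidWord.letter m (i.1, b))) :=
    fun i b => .of (representsFactor_ofBraid_letter hn hd h₃ hT₃ _ (by dsimp only; omega))
  have hmul : ∀ β γ : BraidGroup m,
      IsComposite (RepresentsFactor T₃ d) (ofBraid T₃ T₃ hT₃ hT₃ β) →
      IsComposite (RepresentsFactor T₃ d) (ofBraid T₃ T₃ hT₃ hT₃ γ) →
      IsComposite (RepresentsFactor T₃ d) (ofBraid T₃ T₃ hT₃ hT₃ (β * γ)) := by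
    intro β γ hβ hγ
    rw [← ofBraid_comp_ofBraid hT₃ hT₃ hT₃]
    exact hβ.comp hγ rfl
  have hsigma : ∀ i : Fin (m - 1),
      IsComposite (RepresentsFactor T₃ d) (ofBraid T₃ T₃ hT₃ hT₃ (BraidGroup.sigma i)) := by
    intro i
    simpa [BraidWord.letter] using hlet i true
  have hsigma' : ∀ i : Fin (m - 1),
      IsComposite (RepresentsFactor T₃ d) (ofBraid T₃ T₃ hT₃ hT₃ (BraidGroup.sigma i)⁻¹) := by
    intro i
    simpa [BraidWord.letter] using hlet i false
  induction β using PresentedGroup.induction_on with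
  | _ z =>
    induction z using FreeGroup.induction_on with
    | C1 =>
      rw [map_one, ← mul_inv_cancel (BraidGroup.sigma ⟨0, by omega⟩)]
      exact hmul _ _ (hsigma _) (hsigma' _)
    | of i => exact hsigma i
    | inv_of i _ =>
      rw [map_inv]
      exact hsigma' i
    | mul y z hy hz =>
      rw [map_mul]
      exact hmul _ _ hy hz

/-- Ribbons lead from any tree to `T₃` and back in a single step, so braids between arbitrary
trees reduce to braids on the strands of `T₃`. -/
theorem isComposite_ofBraid (hn : 2 ≤ n) (hd : T₃.depth = d) (hd0 : 0 < d)
    (h₃ : T₃.numFinalCarets = 3) {T T' : NTree n} (hT : T.numLeaves = m) (hT' : T'.numLeaves = m)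
    (hT₃ : T₃.numLeaves = m) (β : BraidGroup m) :
    IsComposite (RepresentsFactor T₃ d) (ofBraid T T' hT hT' β) := by
  have hdT : T.depth = d := hd ▸ NTree.depth_eq_of_numLeaves_eq hn (hT.trans hT₃.symm)
  have hdT' : T'.depth = d := hd ▸ NTree.depth_eq_of_numLeaves_eq hn (hT'.trans hT₃.symm)
  obtain ⟨c₃, hc₃⟩ := T₃.exists_isFinalCaret (by omega)
  obtain ⟨c, hc⟩ := T.exists_isFinalCaret (by omega)
  obtain ⟨c', hc'⟩ := T'.exists_isFinalCaret (by omega)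
  obtain ⟨ρ, hρ⟩ := exists_isRibbon (hT ▸ hc.add_le_numLeaves) (hT₃ ▸ hc₃.add_le_numLeaves)
  obtain ⟨ρ', hρ'⟩ := exists_isRibbon (hT₃ ▸ hc₃.add_le_numLeaves) (hT' ▸ hc'.add_le_numLeaves)
  have h1 : RepresentsFactor T₃ d (ofBraid T T₃ hT hT₃ ρ) :=
    ⟨(depth_mk_lt rfl hc hc₃ hρ.1).trans_eq hdT, m, _, rfl, .inl ⟨rfl, rfl, c, c₃, hc, hc₃, hρ⟩⟩
  have h2 : RepresentsFactor T₃ d (ofBraid T₃ T' hT₃ hT' ρ') :=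
    ⟨(depth_mk_lt rfl hc₃ hc' hρ'.1).trans_eq hd, m, _, rfl,
      .inr (.inl ⟨rfl, rfl, c₃, c', hc₃, hc', hρ'⟩)⟩
  have h3 := (isComposite_ofBraid_self hn hd h₃ hT₃ (ρ⁻¹ * β * ρ'⁻¹)).comp (.of h2) rfl
  rw [ofBraid_comp_ofBraid] at h3
  have h4 := IsComposite.cons rfl h1 h3
  rw [ofBraid_comp_ofBraid] at h4
  simpa [mul_assoc] using h4

/-- On the tree `NTree.fork .leaf (NTree.chain k)`, the label of the first strand is a product of
factors supported on a tree of depth one. -/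
theorem isComposite_ofFirstLabel (hn : 2 ≤ n) (hd : T₃.depth = d) (hd1 : 1 < d)
    (h₃ : T₃.numFinalCarets = 3) {k : ℕ}
    (hk : T₃.numLeaves = (NTree.fork .leaf (NTree.chain k) : NTree n).numLeaves)
    (g : (⊤ : Subgroup (BraidGroup n))) :
    IsComposite (RepresentsFactor T₃ d) (ofFirstLabel (NTree.fork .leaf (NTree.chain k)) g) := by
  have hgen : ∀ (i : Fin (n - 1)) (g : (⊤ : Subgroup (BraidGroup n))),
      (g.1 = BraidGroup.sigma i ∨ g.1 = (BraidGroup.sigma i)⁻¹) →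
      IsComposite (RepresentsFactor T₃ d)
        (ofFirstLabel (NTree.fork .leaf (NTree.chain k)) g) := by
    intro i g hg
    have hdepth : (NTree.fork .leaf .leaf : NTree n).depth = 1 := NTree.depth_fork hn _ _
    refine .of ?_
    rw [RepresentsFactor, mk_ofFirstLabel_fork hn]
    refine ⟨((depth_mk_le _).trans hdepth.le).trans_lt hd1, _, _, rfl,
      .inr (.inr (.inr ⟨rfl, hdepth, rfl, i, g.1, hg, fun q => ?_⟩))⟩
    change ((if q.1 = 0 then g else 1 : (⊤ : Subgroup (BraidGroup n))) : BraidGroup n) = _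
    split_ifs <;> rfl
  have hone : IsComposite (RepresentsFactor T₃ d)
      (ofFirstLabel (NTree.fork .leaf (NTree.chain k)) (1 : (⊤ : Subgroup (BraidGroup n)))) := by
    convert isComposite_ofBraid hn hd (by omega) h₃ rfl rfl hk 1 using 1
    simp only [ofFirstLabel, ofLabel, ofBraid, ite_self]
    rfl
  have hmul : ∀ g h : (⊤ : Subgroup (BraidGroup n)),
      IsComposite (RepresentsFactor T₃ d) (ofFirstLabel (NTree.fork .leaf (NTree.chain k)) g) →
      IsComposite (RepresentsFactor T₃ d) (ofFirstLabel (NTree.fork .leaf (NTree.chain k)) h) →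
      IsComposite (RepresentsFactor T₃ d)
        (ofFirstLabel (NTree.fork .leaf (NTree.chain k)) (g * h)) := by
    intro g h hg hh
    have := (congrArg (IsComposite _) (ofLabel_comp_ofLabel rfl _ _)).mp (hg.comp hh rfl)
    convert this using 1
    refine congrArg (ofLabel _ rfl) ?_
    funext q
    rw [Pi.mul_apply]
    split_ifs <;> simp
  obtain ⟨g, hg⟩ := g
  induction g using PresentedGroup.induction_on with
  | _ z =>
    induction z using FreeGroup.induction_on with
    | C1 => exact hone
    | of i => exact hgen i _ (.inl rfl)
    | inv_of i _ => exact hgen i _ (.inr rfl)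
    | mul y z hy hz => exact hmul ⟨_, trivial⟩ ⟨_, trivial⟩ (hy trivial) (hz trivial)

/-- A braid moving the leaf `q` to the leaf in position `0` of a tree that has this leaf below its
root conjugates the label of `q` to a label of the first strand there; products of such labels are
arbitrary. -/
theorem isComposite_ofLabel (hn : 2 ≤ n) (hd : T₃.depth = d) (hd1 : 1 < d)
    (h₃ : T₃.numFinalCarets = 3) {T : NTree n} (hT : T.numLeaves = m) (hT₃ : T₃.numLeaves = m)
    (l : Fin m → (⊤ : Subgroup (BraidGroup n))) :
    IsComposite (RepresentsFactor T₃ d) (ofLabel T hT l) := by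
  obtain ⟨k, rfl⟩ := Nat.exists_eq_add_of_lt hd1
  have hD : (NTree.fork .leaf (NTree.chain (k + 1)) : NTree n).numLeaves = T₃.numLeaves := by
    refine NTree.numLeaves_eq_of_depth_eq ?_
    rw [NTree.depth_fork hn, NTree.depth_chain hn, hd]
    simp [NTree.depth, add_comm]
  obtain rfl : m = (NTree.fork .leaf (NTree.chain (k + 1)) : NTree n).numLeaves :=
    hT₃.symm.trans hD.symm
  have hsingle : ∀ (a : Fin _) (g : (⊤ : Subgroup (BraidGroup n))),
      IsComposite (RepresentsFactor T₃ (1 + k + 1))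
        (ofLabel T hT fun q => if q = a then g else 1) := by
    intro a g
    have hperm := BraidWord.perm_moveLeft 0 a.1 a (zero_add _).symm
    set γ := (BraidWord.moveLeft 0 a.1).toBraid
      (NTree.fork .leaf (NTree.chain (k + 1)) : NTree n).numLeaves
    have h := (congrArg (IsComposite _) (ofBraid_comp_ofLabel_comp_ofBraid hT rfl γ _)).mp
      (((isComposite_ofBraid hn hd (by omega) h₃ hT rfl hT₃ γ).comp
        (isComposite_ofFirstLabel hn hd hd1 h₃ hT₃ g) rfl).comp
        (isComposite_ofBraid hn hd (by omega) h₃ rfl hT hT₃ γ⁻¹) rfl)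
    convert h using 2
    funext q
    have : (γ.perm q).1 = 0 ↔ q = a := by
      rw [← hperm, ← Fin.ext_iff, γ.perm.injective.eq_iff]
    simp only [Function.comp_apply, this]
  have hone : IsComposite (RepresentsFactor T₃ (1 + k + 1)) (ofLabel T hT 1) :=
    isComposite_ofBraid hn hd (by omega) h₃ hT hT hT₃ 1
  have hs : ∀ s : Finset (Fin (NTree.fork .leaf (NTree.chain (k + 1)) : NTree n).numLeaves),
      IsComposite (RepresentsFactor T₃ (1 + k + 1))
        (ofLabel T hT fun q => if q ∈ s then l q else 1) := by
    intro s
    induction s using Finset.induction_on with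
    | empty =>
      simp only [Finset.notMem_empty, if_false]
      exact hone
    | insert a s ha ih =>
      have h := (hsingle a (l a)).comp ih rfl
      rw [ofLabel_comp_ofLabel] at h
      convert h using 2
      funext q
      rw [Pi.mul_apply]
      by_cases hq : q = a
      · subst hq
        simp [ha]
      · simp [hq]
  simpa using hs Finset.univ

end Factors

theorem mainTheorem7 (n : ℕ) (hn : 2 ≤ n) (H : Subgroup (BraidGroup n)) (d : ℕ) (hd : 4 < d)
    (m : ℕ) (v : BraidedTreePair n H m) (hv : v.dom.depth = d) :
    (∃ T₃ : NTree n, T₃.depth = d ∧ T₃.numFinalCarets = 3) ∧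
    ∀ T₃ : NTree n, T₃.depth = d → T₃.numFinalCarets = 3 →
      ∃ factors : List (BV n (⊤ : Subgroup (BraidGroup n))),
        BV.IsProduct factors (BV.incl le_top (BV.mk v)) ∧
        ∀ x ∈ factors, x.depth < d ∧ IsElementaryFactor T₃ x := by
  refine ⟨NTree.exists_numFinalCarets_eq_three hn hd, fun T₃ hd₃ h₃ => ?_⟩
  have hT₃ : T₃.numLeaves = m :=
    (NTree.numLeaves_eq_of_depth_eq (hd₃.trans hv.symm)).trans v.dom_leaves
  have h := (isComposite_ofBraid hn hd₃ (by omega) h₃ v.dom_leaves v.ran_leaves hT₃ v.braid).comp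
    (isComposite_ofLabel hn hd₃ (by omega) h₃ v.ran_leaves hT₃ (v.incl le_top).label) rfl
  rw [ofBraid_comp_ofLabel] at h
  obtain ⟨l, -, hl, hx⟩ := h.exists_isProduct
  refine ⟨l, hl, fun x hxl => ?_⟩
  obtain ⟨b, hb, rfl⟩ := hx x hxl
  exact hb
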